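/- For an integer $n\ge 1$, let the fan $F_n$ be the graph on $2n+1$ vertices consisting of $n$ triangles that share exactly one common vertex (and are otherwise vertex-disjoint). For a graph $G$, let the Ramsey number $R(G)$ be the smallest positive integer $N$ such that every colouring of the edges of the complete graph $K_N$ in two colours contains a (not necessarily induced) copy of $G$ all of whose edges have the same colour. Then for every $n\ge 1$, the number $R(F_n)$ exists and $$R(F_n)\le \tfrac{31}{6}n+15.$$ Equivalently, for every graph $G$ on $\left\lfloor \tfrac{31}{6}n+15\right\rfloor$ vertices, $G$ or its complement $\overline{G}$ contains $F_n$ as a (not necessarily induced) subgraph. -/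

import Mathlib

/-- The fan `F_n`: `n` triangles sharing exactly one vertex. The centre is `none`, and for `i : Fin n`
the `i`-th triangle is formed by `none`, `some (i, 0)` and `some (i, 1)`. -/
def fanGraph (n : ℕ) : SimpleGraph (Option (Fin n × Fin 2)) where
  Adj
    | none, none => False
    | none, some _ => True
    | some _, none => True
    | some (i, a), some (j, b) => i = j ∧ a ≠ b
  symm := ⟨by
    rintro (_ | ⟨i, a⟩) (_ | ⟨j, b⟩) h
    · exact h
    · trivial
    · trivial
    · exact ⟨h.1.symm, h.2.symm⟩⟩
  loopless := ⟨by
    rintro (_ | ⟨i, a⟩) h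
    · exact h
    · exact h.2 rfl⟩

/-- `IsRamseyFor G H N`: every colouring of the edges of the complete graph `K_N` in two colours
contains a (not necessarily induced) copy of `G` in the first colour or a copy of `H` in the second
colour. -/
def IsRamseyFor {V W : Type*} (G : SimpleGraph V) (H : SimpleGraph W) (N : ℕ) : Prop :=
  ∀ C : SimpleGraph.TopEdgeLabeling (Fin N) (Fin 2),
    G.IsContained (C.labelGraph 0) ∨ H.IsContained (C.labelGraph 1)

/-- The positive integers `N` that are Ramsey for the pair `G`, `H`. -/
def ramseySet {V W : Type*} (G : SimpleGraph V) (H : SimpleGraph W) : Set ℕ :=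
  {N | 0 < N ∧ IsRamseyFor G H N}

/-- The Ramsey number `R(G, H)`: the smallest positive integer that is Ramsey for `G`, `H`
(with the value `0` if there is none). -/
noncomputable def ramseyNumber {V W : Type*} (G : SimpleGraph V) (H : SimpleGraph W) : ℕ :=
  sInf (ramseySet G H)

/-!
Colour the edges of a complete graph red and blue, and suppose that there is no monochromatic `F_n`.
Then no neighbourhood, in either colour, contains `n` disjoint edges of that colour. By the Tutte–Berge
formula (`exists_isBarrier`) this has a certificate: if `A` is a red neighbourhood of size `2n + k`, there
is `S ⊆ A` such that `A \ S` falls into at least `#S + k + 2` classes with only blue edges between them.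
So `A \ S` spans a large blue complete multipartite graph.

Two facts about such a set `P`, blue across its many classes, carry the proof.

* The blue edges that leave `P` are sparse. For `x ∈ P` in a small class, the blue neighbourhood of `x`
  contains nearly all of `P`, which already has nearly `n` disjoint blue edges, so that the blue edges
  from `P` to the blue neighbours of `x` outside `P` are covered by about `2n - #P` vertices
  (`HasBarriers.exists_cover`). Summing the weights `1 / d(w)`, where `d(w)` is the number of blue edges
  from `w` to a set of representatives of the classes, shows that the neighbourhoods of the
  representatives are nearly disjoint (`HasBarriers.mul_le_mul`). Since red degrees are bounded by the
  maximal degree `2n + r`, the blue ones are not small, and this is a strong restriction.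
* If `P` has more than `2n` vertices, then it has a giant class, and every barrier in the blue
  neighbourhood of a vertex in a small class contains all the other classes
  (`HasBarriers.exists_giant_class`). What the barrier leaves of the giant class is, in turn, red across
  many classes.

Let `v` have the largest degree `2n + r` in either colour, say in red, and let `S` be a barrier in its red
neighbourhood. The double count excludes `r ≤ #S` (`IsBarrier.card_lt_of_numeric`), so the rest `P` of the
neighbourhood has a giant class. Let `T` be the union of the other classes. For `y ∈ T` in a small class,
the double count inside the giant class, whose vertices have no red edges to `T`, shows that the blue
degree of `y` is at most about `5n/2` (`card_nbrs_sdiff_le`). Hence `y` has red degree at least about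
`8n/3`, and the same analysis of its red neighbourhood gives a set `P₂`, red across its classes, with at
least about `4n/3` vertices. Each vertex of `T` in a small class has few blue neighbours outside `P`, so
nearly all edges between `T` and `P₂` are red. As `T` has at least about `5n/6` vertices, most of them in
small classes, these edges cannot be covered in the way that `HasBarriers.exists_cover` requires (`false_of_few_nbrs`).
-/

/-! ### Matchings in neighbourhoods and the Tutte–Berge formula -/

section Barriers

open Classical Finset

variable {V : Type*}

/-- `e` lists the `2 * n` ends of `n` pairwise disjoint edges of `H` inside `A`: the `i`-th edge joins
`e (i, 0)` and `e (i, 1)`. -/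
structure IsMatchingIn (H : SimpleGraph V) (n : ℕ) (A : Finset V) (e : Fin n × Fin 2 → V) :
    Prop where
  injective : Function.Injective e
  mem : ∀ p, e p ∈ A
  adj : ∀ i, H.Adj (e (i, 0)) (e (i, 1))

theorem IsMatchingIn.fan_isContained {H : SimpleGraph V} {n : ℕ} {A : Finset V}
    {e : Fin n × Fin 2 → V} (he : IsMatchingIn H n A e) {v : V} (hA : ∀ a ∈ A, H.Adj v a) :
    (fanGraph n).IsContained H := by
  refine ⟨⟨⟨fun o => o.elim v e, ?_⟩, ?_⟩⟩
  · rintro (_ | ⟨i, a⟩) (_ | ⟨j, b⟩) h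
    · exact h.elim
    · exact hA _ (he.mem _)
    · exact (hA _ (he.mem _)).symm
    · obtain ⟨rfl, hab⟩ := h
      change H.Adj (e (i, a)) (e (i, b))
      have key := he.adj i
      fin_cases a <;> fin_cases b
      · exact absurd rfl hab
      · exact key
      · exact key.symm
      · exact absurd rfl hab
  · rintro (_ | p) (_ | q) h
    · rfl
    · exact absurd h.symm (hA _ (he.mem q)).ne'
    · exact absurd h (hA _ (he.mem p)).ne'
    · exact congrArg some (he.injective h)

/-- The pairs of a fixed-point-free involution along edges of `H` form a matching. -/
theorem exists_isMatchingIn_of_involution {H : SimpleGraph V} (σ : V → V) (n : ℕ) :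
    ∀ T : Finset V, (∀ a ∈ T, σ a ∈ T ∧ σ (σ a) = a ∧ H.Adj a (σ a)) → 2 * n ≤ T.card →
      ∃ e, IsMatchingIn H n T e := by
  induction n with
  | zero =>
    intro T _ _
    exact ⟨fun p => p.1.elim0, fun p => p.1.elim0, fun p => p.1.elim0, fun i => i.elim0⟩
  | succ n ih =>
    intro T hT hcard
    obtain ⟨a, ha⟩ : T.Nonempty := card_pos.1 (by omega)
    obtain ⟨h1, h2, h3⟩ := hT a ha
    have hT' : ∀ b ∈ (T.erase a).erase (σ a),
        σ b ∈ (T.erase a).erase (σ a) ∧ σ (σ b) = b ∧ H.Adj b (σ b) := by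
      intro b hb
      simp only [mem_erase] at hb ⊢
      obtain ⟨k1, k2, k3⟩ := hT b hb.2.2
      refine ⟨⟨fun h => hb.2.1 ?_, fun h => hb.1 ?_, k1⟩, k2, k3⟩
      · rw [← k2, h, h2]
      · rw [← k2, h]
    have hc : ((T.erase a).erase (σ a)).card = T.card - 1 - 1 := by
      rw [card_erase_of_mem (mem_erase.2 ⟨h3.ne', h1⟩), card_erase_of_mem ha]
    obtain ⟨e, he⟩ := ih _ hT' (by omega)
    have hne : ∀ p, e p ≠ a ∧ e p ≠ σ a ∧ e p ∈ T := fun p => by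
      have := he.mem p
      simp only [mem_erase] at this
      exact ⟨this.2.1, this.1, this.2.2⟩
    refine ⟨fun p => Fin.cases (if p.2 = 0 then a else σ a) (fun i => e (i, p.2)) p.1, ?_, ?_, ?_⟩
    · rintro ⟨i, x⟩ ⟨j, y⟩ h
      induction i using Fin.cases with
      | zero =>
        induction j using Fin.cases with
        | zero =>
          fin_cases x <;> fin_cases y <;> simp_all [h3.ne, h3.ne']
        | succ j =>
          simp only [Fin.cases_zero, Fin.cases_succ] at h
          split_ifs at h
          · exact absurd h.symm (hne _).1
          · exact absurd h.symm (hne _).2.1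
      | succ i =>
        induction j using Fin.cases with
        | zero =>
          simp only [Fin.cases_zero, Fin.cases_succ] at h
          split_ifs at h
          · exact absurd h (hne _).1
          · exact absurd h (hne _).2.1
        | succ j =>
          simp only [Fin.cases_succ] at h
          have := he.injective h
          simp_all
    · rintro ⟨i, x⟩
      induction i using Fin.cases with
      | zero =>
        simp only [Fin.cases_zero]
        split_ifs
        · exact ha
        · exact h1
      | succ i => simpa using (hne (i, x)).2.2
    · intro i
      induction i using Fin.cases with
      | zero => simpa using h3
      | succ i => simpa using he.adj i

/-- A certificate, of the kind given by the Tutte–Berge formula, that `H` has no `n` pairwise disjoint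
edges inside `A`: after the removal of `S`, the labelling `g` is constant on the connected components
of `H` on `A \ S`, and the number of labels is large. Two vertices of `A \ S` with distinct labels are
not adjacent in `H`. -/
structure IsBarrier (H : SimpleGraph V) (n : ℕ) (A S : Finset V) (g : V → V) : Prop where
  subset : S ⊆ A
  eq_of_adj : ∀ a ∈ A \ S, ∀ b ∈ A \ S, H.Adj a b → g a = g b
  card_le : A.card + S.card + 2 ≤ 2 * n + ((A \ S).image g).card

theorem IsBarrier.card_lt {H : SimpleGraph V} {n : ℕ} {A S : Finset V} {g : V → V}
    (h : IsBarrier H n A S g) : S.card < n := by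
  have h1 := h.card_le
  have h2 : ((A \ S).image g).card ≤ (A \ S).card := card_image_le
  have h3 := card_sdiff_of_subset h.subset
  have h4 := card_le_card h.subset
  omega

/-- The graph that `H` induces on `A`, joined to a complete graph on `k` new vertices. -/
def inducedJoin (H : SimpleGraph V) (A : Finset V) (k : ℕ) : SimpleGraph (A ⊕ Fin k) :=
  SimpleGraph.fromRel fun x y => ∀ a b, x = Sum.inl a → y = Sum.inl b → H.Adj a b

theorem inducedJoin_adj_inl {H : SimpleGraph V} {A : Finset V} {k : ℕ} (a b : A) :
    (inducedJoin H A k).Adj (Sum.inl a) (Sum.inl b) ↔ H.Adj a b := by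
  simp only [inducedJoin, SimpleGraph.fromRel_adj]
  constructor
  · rintro ⟨-, h | h⟩
    · exact h _ _ rfl rfl
    · exact (h _ _ rfl rfl).symm
  · intro h
    refine ⟨fun h' => h.ne (by rw [Sum.inl.inj h']), Or.inl ?_⟩
    rintro _ _ h1 h2
    rwa [← Sum.inl.inj h1, ← Sum.inl.inj h2]

theorem inducedJoin_adj_inr {H : SimpleGraph V} {A : Finset V} {k : ℕ} (i : Fin k)
    (x : A ⊕ Fin k) (hx : x ≠ Sum.inr i) : (inducedJoin H A k).Adj x (Sum.inr i) := by
  simp only [inducedJoin, SimpleGraph.fromRel_adj]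
  exact ⟨hx, Or.inl fun _ _ _ h => by cases h⟩

/-- A perfect matching of the join leaves at most `k` vertices of `A` matched outside `A`. -/
theorem exists_isMatchingIn_of_isPerfectMatching {H : SimpleGraph V} {n k : ℕ} {A : Finset V}
    (hk : A.card = 2 * n + k) {M : (inducedJoin H A k).Subgraph} (hM : M.IsPerfectMatching) :
    ∃ e, IsMatchingIn H n A e := by
  rw [SimpleGraph.Subgraph.isPerfectMatching_iff] at hM
  choose m hm hu using hM
  have hmm : ∀ x, m (m x) = x := fun x => (hu _ _ (hm x).symm).symm
  let σ : V → V := fun v => if h : v ∈ A then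
    Sum.elim (fun a : A => (a : V)) (fun _ => v) (m (Sum.inl ⟨v, h⟩)) else v
  let T : Finset V := (univ.filter fun a : A => ∃ b : A, m (Sum.inl a) = Sum.inl b).image (↑)
  have hσ : ∀ a b : A, m (Sum.inl a) = Sum.inl b → σ a = b := by
    intro a b h
    simp only [σ, a.2, dif_pos, Subtype.coe_eta, h, Sum.elim_inl]
  have hT : ∀ a ∈ T, σ a ∈ T ∧ σ (σ a) = a ∧ H.Adj a (σ a) := by
    intro a ha
    obtain ⟨a, ha', rfl⟩ := mem_image.1 ha
    obtain ⟨b, hb⟩ := (mem_filter.1 ha').2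
    have hb' : m (Sum.inl b) = Sum.inl a := by rw [← hb, hmm]
    rw [hσ a b hb, hσ b a hb']
    refine ⟨mem_image.2 ⟨b, mem_filter.2 ⟨mem_univ _, a, hb'⟩, rfl⟩, rfl, ?_⟩
    have := (hm (Sum.inl a)).adj_sub
    rw [hb] at this
    exact (inducedJoin_adj_inl a b).1 this
  have hcard : 2 * n ≤ T.card := by
    have h1 : T.card = (univ.filter fun a : A => ∃ b : A, m (Sum.inl a) = Sum.inl b).card :=
      card_image_of_injective _ Subtype.val_injective
    have h2 := card_filter_add_card_filter_not (s := (univ : Finset A))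
      (fun a : A => ∃ b : A, m (Sum.inl a) = Sum.inl b)
    have h3 : (univ.filter fun a : A => ¬ ∃ b : A, m (Sum.inl a) = Sum.inl b).card ≤
        (univ : Finset (Fin k)).card := by
      have hinj : Function.Injective fun a : A => m (Sum.inl a) := fun a b h => by
        have h' : m (m (Sum.inl a)) = m (m (Sum.inl b)) := congrArg m h
        rw [hmm, hmm] at h'
        exact Sum.inl.inj h'
      rw [← card_image_of_injective _ hinj,
        ← card_image_of_injective (univ : Finset (Fin k)) (Sum.inr_injective (α := A))]
      refine card_le_card fun x hx => ?_
      obtain ⟨a, ha, rfl⟩ := mem_image.1 hx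
      cases h : m (Sum.inl a) with
      | inl b => exact absurd ⟨b, h⟩ (mem_filter.1 ha).2
      | inr i => exact mem_image_of_mem _ (mem_univ i)
    simp only [card_univ, Fintype.card_coe, Fintype.card_fin] at h2 h3
    omega
  obtain ⟨e, he⟩ := exists_isMatchingIn_of_involution σ n T hT hcard
  refine ⟨e, he.injective, fun p => ?_, he.adj⟩
  obtain ⟨a, -, ha⟩ := mem_image.1 (he.mem p)
  rw [← ha]
  exact a.2

/-- The Tutte–Berge formula: Tutte's theorem for the join with a complete graph on `#A - 2 * n`
vertices. A Tutte violator contains all the new vertices, since any one of them makes the rest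
connected, and its remaining part is the set `S`. -/
theorem exists_isBarrier {H : SimpleGraph V} {n : ℕ} (hn : 1 ≤ n) (A : Finset V)
    (hno : ¬ ∃ e, IsMatchingIn H n A e) : ∃ S g, IsBarrier H n A S g := by
  rcases lt_or_ge A.card (2 * n) with hlt | hge
  · rcases A.eq_empty_or_nonempty with rfl | hA
    · exact ⟨∅, id, by simp, by simp, by simp; omega⟩
    · obtain ⟨a, ha⟩ := hA
      refine ⟨∅, fun _ => a, by simp, by simp, ?_⟩
      rw [sdiff_empty, image_const ⟨a, ha⟩]
      simp
      omega
  obtain ⟨k, hk⟩ := Nat.exists_eq_add_of_le hge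
  have hnp : ∀ M : (inducedJoin H A k).Subgraph, ¬ M.IsPerfectMatching := fun M hM =>
    hno (exists_isMatchingIn_of_isPerfectMatching hk hM)
  obtain ⟨U, hU⟩ : ∃ U, (inducedJoin H A k).IsTutteViolator U := by
    by_contra! h
    obtain ⟨M, hM⟩ := SimpleGraph.tutte.2 h
    exact hnp M hM
  rw [SimpleGraph.IsTutteViolator] at hU
  set K := ((⊤ : (inducedJoin H A k).Subgraph).deleteVerts U) with hK
  have hcardK : Nat.card K.verts + U.ncard = A.card + k := by
    have h1 : K.verts = Uᶜ := by simp [hK, Set.compl_eq_univ_sdiff]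
    rw [Nat.card_coe_set_eq, h1, add_comm, Set.ncard_add_ncard_compl]
    simp
  have hpar := SimpleGraph.odd_ncard_oddComponents (G := K.coe)
  have hadj : ∀ x y : K.verts, K.coe.Adj x y ↔ (inducedJoin H A k).Adj x y := by
    intro x y
    have hx := x.2
    have hy := y.2
    simp [hK] at hx hy ⊢
    tauto
  -- the violator contains the new vertices
  have hinr : ∀ i : Fin k, (Sum.inr i : A ⊕ Fin k) ∈ U := by
    intro i
    by_contra hi
    have hiK : (Sum.inr i : A ⊕ Fin k) ∈ K.verts := by simpa [hK] using hi
    have hsub : ∀ c : K.coe.ConnectedComponent, c = K.coe.connectedComponentMk ⟨_, hiK⟩ := by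
      intro c
      induction c using SimpleGraph.ConnectedComponent.ind with
      | _ x =>
        by_cases hx : x = ⟨_, hiK⟩
        · rw [hx]
        · refine SimpleGraph.ConnectedComponent.sound (SimpleGraph.Adj.reachable ?_)
          exact (hadj _ _).2 (inducedJoin_adj_inr i _ fun h => hx (Subtype.ext h))
    have hle : K.coe.oddComponents.ncard ≤ 1 := by
      rw [Set.ncard_le_one_iff]
      intro a b _ _
      rw [hsub a, hsub b]
    have h1 : K.coe.oddComponents.ncard = 1 := by omega
    rw [h1] at hpar
    have h2 := hpar.1 odd_one
    rw [Nat.odd_iff] at h2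
    omega
  let S : Finset V := (univ.filter fun a : A => Sum.inl a ∈ U).image (↑)
  have hScard : S.card + k = U.ncard := by
    have hUeq : U = (Sum.inl '' {a : A | Sum.inl a ∈ U}) ∪ Set.range Sum.inr := by
      ext x
      cases x with
      | inl a => simp
      | inr i => simp [hinr i]
    rw [hUeq, Set.ncard_union_eq, Set.ncard_image_of_injective _ Sum.inl_injective]
    · have h1 : S.card = (univ.filter fun a : A => Sum.inl a ∈ U).card :=
        card_image_of_injective _ Subtype.val_injective
      rw [h1, ← Set.ncard_coe_finset, ← Set.image_univ,
        Set.ncard_image_of_injective _ Sum.inr_injective]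
      simp
    · rw [Set.disjoint_left]
      rintro _ ⟨a, -, rfl⟩ ⟨i, hi⟩
      cases hi
  have hmemK : ∀ a (ha : a ∈ A), a ∉ S → (Sum.inl ⟨a, ha⟩ : A ⊕ Fin k) ∈ K.verts := by
    intro a ha haS
    have : (Sum.inl ⟨a, ha⟩ : A ⊕ Fin k) ∉ U := fun h =>
      haS (mem_image.2 ⟨⟨a, ha⟩, mem_filter.2 ⟨mem_univ _, h⟩, rfl⟩)
    simpa [hK] using this
  have hKmem : ∀ x : K.verts, ∃ a, ∃ ha : a ∈ A, a ∉ S ∧ x.1 = Sum.inl ⟨a, ha⟩ := by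
    rintro ⟨x, hx⟩
    have hxU : x ∉ U := by simpa [hK] using hx
    cases x with
    | inl a =>
      refine ⟨a, a.2, fun h => ?_, rfl⟩
      obtain ⟨b, hb, hba⟩ := mem_image.1 h
      have : b = a := Subtype.ext hba
      exact hxU (this ▸ (mem_filter.1 hb).2)
    | inr i => exact absurd (hinr i) hxU
  -- every component is labelled by one of its vertices
  let lab : K.coe.ConnectedComponent → V := fun c => (hKmem c.out).choose
  have hlab : Function.Injective lab := by
    intro c d h
    obtain ⟨ha, -, hc⟩ := (hKmem c.out).choose_spec
    obtain ⟨hb, -, hd⟩ := (hKmem d.out).choose_spec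
    have : c.out = d.out := by
      apply Subtype.ext
      rw [hc, hd]
      congr 2
    rw [← c.out_eq, ← d.out_eq, this]
  let g : V → V := fun a => if h : a ∈ A ∧ a ∉ S then
    lab (K.coe.connectedComponentMk ⟨Sum.inl ⟨a, h.1⟩, hmemK a h.1 h.2⟩) else a
  refine ⟨S, g, ?_, ?_, ?_⟩
  · intro a ha
    obtain ⟨b, -, rfl⟩ := mem_image.1 ha
    exact b.2
  · intro a ha b hb hab
    rw [mem_sdiff] at ha hb
    simp only [g, dif_pos ha, dif_pos hb]
    congr 1
    refine SimpleGraph.ConnectedComponent.sound (SimpleGraph.Adj.reachable ?_)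
    exact (hadj _ _).2 ((inducedJoin_adj_inl _ _).2 hab)
  · have h1 : K.coe.oddComponents.ncard ≤ ((A \ S).image g).card := by
      rw [← Set.ncard_image_of_injective _ hlab, ← Set.ncard_coe_finset]
      refine Set.ncard_le_ncard ?_ (Finset.finite_toSet _)
      rintro _ ⟨c, -, rfl⟩
      obtain ⟨a, ha, haS, hc⟩ := hKmem c.out
      refine mem_coe.2 (mem_image.2 ⟨a, mem_sdiff.2 ⟨ha, haS⟩, ?_⟩)
      simp only [g, dif_pos (And.intro ha haS)]
      congr 1
      rw [← c.out_eq]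
      congr 1
      exact Subtype.ext hc.symm
    have h2 : U.ncard + 2 ≤ K.coe.oddComponents.ncard := by
      rw [Nat.odd_iff, Nat.odd_iff] at hpar
      omega
    omega

end Barriers

/-! ### Sets across whose classes a graph is complete -/

section Counting

open Classical Finset

variable {V : Type*}

/-- Inside every neighbourhood of `H` there are fewer than `n` disjoint edges, as certified by a
barrier. -/
def HasBarriers (H : SimpleGraph V) (n : ℕ) : Prop :=
  ∀ x, ∀ A : Finset V, (∀ a ∈ A, H.Adj x a) → ∃ S g, IsBarrier H n A S g

theorem hasBarriers_of_not_isContained {H : SimpleGraph V} {n : ℕ} (hn : 1 ≤ n)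
    (h : ¬ (fanGraph n).IsContained H) : HasBarriers H n := fun _ A hA =>
  exists_isBarrier hn A fun ⟨_, he⟩ => h (he.fan_isContained hA)

/-- Any two vertices of `P` with distinct labels are adjacent in `H`. -/
def CompleteAcross (H : SimpleGraph V) (P : Finset V) (f : V → V) : Prop :=
  ∀ a ∈ P, ∀ b ∈ P, f a ≠ f b → H.Adj a b

/-- The vertices of `P` with the same label as `x`. -/
noncomputable def labelClass (P : Finset V) (f : V → V) (x : V) : Finset V :=
  P.filter fun a => f a = f x

theorem mem_labelClass {P : Finset V} {f : V → V} {x a : V} :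
    a ∈ labelClass P f x ↔ a ∈ P ∧ f a = f x := mem_filter

theorem card_labelClass_pos {P : Finset V} {f : V → V} {x : V} (hx : x ∈ P) :
    0 < (labelClass P f x).card := card_pos.2 ⟨x, mem_labelClass.2 ⟨hx, rfl⟩⟩

theorem card_sdiff_labelClass (P : Finset V) (f : V → V) (x : V) :
    (P \ labelClass P f x).card + (labelClass P f x).card = P.card :=
  card_sdiff_add_card_eq_card (filter_subset _ _)

theorem card_image_le_card_add_two {P S : Finset V} {f : V → V} {κ μ : V}
    (h : ∀ a ∈ P, f a ≠ κ → f a ≠ μ → a ∈ S) : (P.image f).card ≤ S.card + 2 := by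
  have h1 : P.image f ⊆ insert κ (insert μ (S.image f)) := by
    intro c hc
    obtain ⟨a, ha, rfl⟩ := mem_image.1 hc
    simp only [mem_insert]
    by_cases h1 : f a = κ
    · exact Or.inl h1
    by_cases h2 : f a = μ
    · exact Or.inr (Or.inl h2)
    exact Or.inr (Or.inr (mem_image_of_mem f (h a ha h1 h2)))
  have h2 := card_le_card h1
  have h3 := card_insert_le κ (insert μ (S.image f))
  have h4 := card_insert_le μ (S.image f)
  have h5 : (S.image f).card ≤ S.card := card_image_le
  omega

theorem card_labelClass_add_card_labelClass_le {P : Finset V} {f : V → V} {x y : V}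
    (hxy : f x ≠ f y) :
    (labelClass P f x).card + (labelClass P f y).card + (P.image f).card ≤ P.card + 2 := by
  have h1 : (P.image f).card ≤ ((P \ labelClass P f x) \ labelClass P f y).card + 2 :=
    card_image_le_card_add_two fun a ha h1 h2 => by
      simp only [mem_sdiff, mem_labelClass]
      tauto
  have h2 := card_sdiff_labelClass P f x
  have h3 : ((P \ labelClass P f x) \ labelClass P f y).card + (labelClass P f y).card =
      (P \ labelClass P f x).card := by
    refine card_sdiff_add_card_eq_card fun a ha => ?_
    rw [mem_labelClass] at ha
    exact mem_sdiff.2 ⟨ha.1, fun h => hxy ((mem_labelClass.1 h).2.symm.trans ha.2)⟩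
  omega

theorem exists_card_labelClass_mul_le {P : Finset V} (f : V → V) (hP : P.Nonempty) :
    ∃ x ∈ P, (labelClass P f x).card * (P.image f).card ≤ P.card := by
  obtain ⟨x, hx, hmin⟩ := exists_min_image P (fun x => (labelClass P f x).card) hP
  refine ⟨x, hx, ?_⟩
  rw [card_eq_sum_card_image f P, mul_comm, ← smul_eq_mul]
  refine card_nsmul_le_sum _ _ _ fun c hc => ?_
  obtain ⟨y, hy, rfl⟩ := mem_image.1 hc
  exact hmin y hy

/-- Classes with more than four elements are few. -/
theorem five_mul_card_image_le (P : Finset V) (f : V → V) :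
    5 * (P.image f).card ≤
      P.card + 4 * (P.filter fun x => (labelClass P f x).card ≤ 4).card := by
  have h1 := card_eq_sum_card_image f P
  have h2 : (P.filter fun x => (labelClass P f x).card ≤ 4).card = ∑ c ∈ P.image f,
      ((P.filter fun x => (labelClass P f x).card ≤ 4).filter fun a => f a = c).card :=
    card_eq_sum_card_fiberwise fun a ha => mem_image_of_mem f (mem_filter.1 ha).1
  rw [h1, h2, mul_sum, ← sum_add_distrib, mul_comm, ← smul_eq_mul]
  refine card_nsmul_le_sum _ _ _ fun c hc => ?_
  obtain ⟨y, hy, rfl⟩ := mem_image.1 hc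
  have hpos := card_labelClass_pos (f := f) hy
  change 5 ≤ (labelClass P f y).card + _
  by_cases h4 : (labelClass P f y).card ≤ 4
  · have : (P.filter fun x => (labelClass P f x).card ≤ 4).filter (fun a => f a = f y) =
        labelClass P f y := by
      ext a
      simp only [mem_filter, mem_labelClass]
      refine ⟨fun h => ⟨h.1.1, h.2⟩, fun h => ⟨⟨h.1, ?_⟩, h.2⟩⟩
      rwa [labelClass, h.2, ← labelClass]
    rw [this]
    omega
  · omega

/-- If `H` is complete across the classes of `P ⊆ A` and two classes survive the removal of `S`, then
the rest of `P` is connected. -/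
theorem IsBarrier.label_eq {H : SimpleGraph V} {n : ℕ} {A S P : Finset V} {f g : V → V}
    (hS : IsBarrier H n A S g) (hf : CompleteAcross H P f) (hPA : P ⊆ A) {a₀ b₀ : V}
    (ha₀ : a₀ ∈ P \ S) (hb₀ : b₀ ∈ P \ S) (hab : f a₀ ≠ f b₀) {a : V} (ha : a ∈ P \ S) :
    g a = g a₀ := by
  have hadj : ∀ a ∈ P \ S, ∀ b ∈ P \ S, f a ≠ f b → g a = g b := by
    intro a ha b hb hab
    rw [mem_sdiff] at ha hb
    exact hS.eq_of_adj a (mem_sdiff.2 ⟨hPA ha.1, ha.2⟩) b (mem_sdiff.2 ⟨hPA hb.1, hb.2⟩)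
      (hf a ha.1 b hb.1 hab)
  by_cases h : f a = f a₀
  · rw [hadj a ha b₀ hb₀ (h ▸ hab), hadj a₀ ha₀ b₀ hb₀ hab]
  · exact hadj a ha a₀ ha₀ h

/-- In the situation of `IsBarrier.label_eq`, the labels other than that of `P` lie on `A \ P`. -/
theorem IsBarrier.card_add_card_le {H : SimpleGraph V} {n : ℕ} {A S P : Finset V} {f g : V → V}
    (hS : IsBarrier H n A S g) (hf : CompleteAcross H P f) (hPA : P ⊆ A) {a₀ b₀ : V}
    (ha₀ : a₀ ∈ P \ S) (hb₀ : b₀ ∈ P \ S) (hab : f a₀ ≠ f b₀) :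
    P.card + S.card + 1 + ((A \ P).filter fun w => w ∈ S ∨ g w = g a₀).card ≤ 2 * n := by
  set Y := (A \ P).filter (fun w => w ∈ S ∨ g w = g a₀) with hY
  have h1 : (A \ S).image g ⊆ insert (g a₀) (((A \ P) \ Y).image g) := by
    intro c hc
    obtain ⟨a, ha, rfl⟩ := mem_image.1 hc
    rw [mem_sdiff] at ha
    by_cases h : g a = g a₀
    · rw [h]
      exact mem_insert_self _ _
    refine mem_insert_of_mem (mem_image_of_mem g (mem_sdiff.2 ⟨mem_sdiff.2 ⟨ha.1, fun h' => ?_⟩, ?_⟩))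
    · exact h (hS.label_eq hf hPA ha₀ hb₀ hab (mem_sdiff.2 ⟨h', ha.2⟩))
    · simp only [hY, mem_filter]
      tauto
  have h2 := card_le_card h1
  have h3 := card_insert_le (g a₀) (((A \ P) \ Y).image g)
  have h4 : (((A \ P) \ Y).image g).card ≤ ((A \ P) \ Y).card := card_image_le
  have h5 : ((A \ P) \ Y).card + Y.card = (A \ P).card :=
    card_sdiff_add_card_eq_card (filter_subset _ _)
  have h6 : (A \ P).card + P.card = A.card := card_sdiff_add_card_eq_card hPA
  have h7 := hS.card_le
  omega

/-- If `H` is complete across at least `n + 2` classes of `P`, then the edges of `H` from `P` to the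
outside neighbours of `x ∈ P` are covered by few vertices. -/
theorem HasBarriers.exists_cover {H : SimpleGraph V} {n : ℕ} (hH : HasBarriers H n) {P : Finset V}
    {f : V → V} (hf : CompleteAcross H P f) (hq : n + 2 ≤ (P.image f).card) {x : V} (hx : x ∈ P)
    {R : Finset V} (hR : ∀ w ∈ R, H.Adj x w) (hRP : Disjoint P R) :
    ∃ X ⊆ P, ∃ Y ⊆ R, X.card + Y.card + P.card + 1 ≤ 2 * n + (labelClass P f x).card ∧
      ∀ w ∈ R, w ∉ Y → ∀ a ∈ P, a ∉ X → f a ≠ f x → ¬ H.Adj w a := by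
  set P' := P \ labelClass P f x with hP'
  have hmem : ∀ a, a ∈ P' ↔ a ∈ P ∧ f a ≠ f x := by
    intro a
    simp only [hP', mem_sdiff, mem_labelClass]
    tauto
  obtain ⟨S, g, hS⟩ := hH x (P' ∪ R) (by
    intro a ha
    rcases mem_union.1 ha with h | h
    · exact hf x hx a ((hmem a).1 h).1 ((hmem a).1 h).2.symm
    · exact hR a h)
  have hlt := hS.card_lt
  -- at least two classes avoid `S`, so all labels `g` on `P' \ S` agree
  have htwo : 1 < ((P' \ S).image f).card := by
    have hsub : P.image f ⊆ insert (f x) (S.image f ∪ (P' \ S).image f) := by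
      intro c hc
      obtain ⟨a, ha, rfl⟩ := mem_image.1 hc
      by_cases h1 : f a = f x
      · rw [h1]
        exact mem_insert_self _ _
      refine mem_insert_of_mem (mem_union.2 ?_)
      by_cases h2 : a ∈ S
      · exact Or.inl (mem_image_of_mem f h2)
      · exact Or.inr (mem_image_of_mem f (mem_sdiff.2 ⟨(hmem a).2 ⟨ha, h1⟩, h2⟩))
    have h1 := card_le_card hsub
    have h2 := card_insert_le (f x) (S.image f ∪ (P' \ S).image f)
    have h3 := card_union_le (S.image f) ((P' \ S).image f)
    have h4 : (S.image f).card ≤ S.card := card_image_le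
    omega
  obtain ⟨c, hc, d, hd, hcd⟩ := one_lt_card.1 htwo
  obtain ⟨a₀, ha₀, rfl⟩ := mem_image.1 hc
  obtain ⟨b₀, hb₀, rfl⟩ := mem_image.1 hd
  have hf' : CompleteAcross H P' f := fun a ha b hb =>
    hf a ((hmem a).1 ha).1 b ((hmem b).1 hb).1
  have hconst : ∀ a ∈ P' \ S, g a = g a₀ := fun a ha =>
    hS.label_eq hf' subset_union_left ha₀ hb₀ hcd ha
  refine ⟨S ∩ P, inter_subset_right, R.filter (fun w => w ∈ S ∨ g w = g a₀), filter_subset _ _,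
    ?_, ?_⟩
  · have h1 := hS.card_add_card_le hf' subset_union_left ha₀ hb₀ hcd
    rw [union_sdiff_cancel_left (hRP.mono_left sdiff_subset)] at h1
    have h2 := card_sdiff_labelClass P f x
    have h3 : (S ∩ P).card ≤ S.card := card_le_card inter_subset_left
    rw [← hP'] at h2
    omega
  · intro w hw hwY a ha haX hax hwa
    have h1 : ¬ (w ∈ S ∨ g w = g a₀) := fun h => hwY (mem_filter.2 ⟨hw, h⟩)
    have h2 : a ∉ S := fun h => haX (mem_inter.2 ⟨h, ha⟩)
    have h3 : a ∈ P' := (hmem a).2 ⟨ha, hax⟩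
    refine h1 (Or.inr ?_)
    rw [← hconst a (mem_sdiff.2 ⟨h3, h2⟩)]
    exact hS.eq_of_adj w (mem_sdiff.2 ⟨mem_union_right _ hw, fun h => h1 (Or.inl h)⟩) a
      (mem_sdiff.2 ⟨mem_union_left _ h3, h2⟩) hwa

theorem HasBarriers.card_le_two_mul {H : SimpleGraph V} {n : ℕ} (hH : HasBarriers H n)
    {P : Finset V} {f : V → V} (hf : CompleteAcross H P f) (hq : n + 2 ≤ (P.image f).card) :
    P.card ≤ 2 * n := by
  have hpos : 0 < (P.image f).card := by omega
  have hP : P.Nonempty := image_nonempty.1 (card_pos.1 hpos)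
  obtain ⟨x, hx, hle⟩ := exists_card_labelClass_mul_le f hP
  obtain ⟨X, -, Y, -, h, -⟩ := hH.exists_cover hf hq hx (R := ∅) (by simp) (by simp)
  by_contra! hlt
  obtain ⟨e, he⟩ := Nat.exists_eq_add_of_lt hlt
  have h1 : e + 2 ≤ (labelClass P f x).card := by omega
  have h2 := Nat.mul_le_mul h1 hq
  nlinarith

end Counting

/-! ### The double count over one representative per class -/

section DoubleCounting

open Classical Finset

variable {V : Type*}

theorem isCompl_adj_iff {H K : SimpleGraph V} (h : IsCompl H K) {a b : V} (hab : a ≠ b) :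
    H.Adj a b ↔ ¬ K.Adj a b := by
  rw [h.symm.compl_eq.symm, SimpleGraph.compl_adj]
  exact ⟨fun h => h.2, fun h => ⟨hab, h⟩⟩

/-- The weighted double count. Here `R x` is the set of neighbours of `x` in `W`, and the edges between `Q`
and `R x` are covered by `X ∪ Y ∪ {x}`, which has at most `D x` vertices. When every `w ∈ W` shares a
weight of at most `1` equally among its neighbours in `Q`, each `x` receives at least `ρ / D x`. -/
theorem sum_div_le_card {E : V → V → Prop} {Q W : Finset V} {R : V → Finset V} {D : V → ℕ} {ρ : ℝ}
    (hR : ∀ x ∈ Q, ∀ w, w ∈ R x ↔ w ∈ W ∧ E w x) (hρ : ∀ x ∈ Q, ρ ≤ (R x).card)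
    (hD : ∀ x ∈ Q, (D x : ℝ) ≤ ρ)
    (hcov : ∀ x ∈ Q, ∃ X Y : Finset V, Y ⊆ R x ∧ X.card + Y.card + 1 ≤ D x ∧
      ∀ w ∈ R x, w ∉ Y → ∀ a ∈ Q, a ∉ X → a ≠ x → ¬ E w a) :
    ∑ x ∈ Q, ρ / D x ≤ W.card := by
  let d : V → ℕ := fun w => (Q.filter fun a => E w a).card
  have hsum : ∀ x ∈ Q, ρ / D x ≤ ∑ w ∈ R x, (1 : ℝ) / d w := by
    intro x hx
    obtain ⟨X, Y, hY, hcard, hno⟩ := hcov x hx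
    have hdle : ∀ w ∈ R x \ Y, d w ≤ X.card + 1 ∧ 0 < d w := by
      intro w hw
      rw [mem_sdiff] at hw
      constructor
      · refine le_trans (card_le_card ?_) (card_insert_le x X)
        intro a ha
        rw [mem_filter] at ha
        by_contra hax
        rw [mem_insert, not_or] at hax
        exact hno w hw.1 hw.2 a ha.1 hax.2 hax.1 ha.2
      · exact card_pos.2 ⟨x, mem_filter.2 ⟨hx, ((hR x hx w).1 hw.1).2⟩⟩
    have h1 : ∑ w ∈ R x \ Y, (1 : ℝ) / (X.card + 1 : ℝ) ≤ ∑ w ∈ R x, (1 : ℝ) / d w := by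
      refine (sum_le_sum fun w hw => ?_).trans
        (sum_le_sum_of_subset_of_nonneg sdiff_subset fun _ _ _ => by positivity)
      obtain ⟨k1, k2⟩ := hdle w hw
      have k1' : (d w : ℝ) ≤ X.card + 1 := by exact_mod_cast k1
      have k2' : (0 : ℝ) < d w := by exact_mod_cast k2
      exact one_div_le_one_div_of_le k2' k1'
    refine le_trans ?_ h1
    have h2 : ((R x \ Y).card : ℝ) + Y.card = (R x).card := by
      exact_mod_cast card_sdiff_add_card_eq_card hY
    have h3 : (X.card : ℝ) + Y.card + 1 ≤ D x := by exact_mod_cast hcard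
    have hX0 : (0 : ℝ) ≤ X.card := by positivity
    have hY0 : (0 : ℝ) ≤ Y.card := by positivity
    have h4 := hρ x hx
    have h5 := hD x hx
    rw [sum_const, nsmul_eq_mul, mul_one_div, div_le_div_iff₀ (by linarith) (by linarith)]
    have h6 : ρ - Y.card ≤ (R x \ Y).card := by linarith
    nlinarith [mul_le_mul_of_nonneg_right h6 (show (0 : ℝ) ≤ D x by linarith),
      mul_le_mul_of_nonneg_left h5 hY0,
      mul_le_mul_of_nonneg_left h3 (show (0 : ℝ) ≤ ρ by linarith)]
  calc ∑ x ∈ Q, ρ / D x ≤ ∑ x ∈ Q, ∑ w ∈ R x, (1 : ℝ) / d w := sum_le_sum hsum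
    _ = ∑ w ∈ W, ∑ x ∈ Q.filter (fun a => E w a), (1 : ℝ) / d w := by
        refine sum_comm' fun x w => ?_
        rw [mem_filter]
        constructor
        · rintro ⟨hx, hw⟩
          have := (hR x hx w).1 hw
          exact ⟨⟨hx, this.2⟩, this.1⟩
        · rintro ⟨⟨hx, hE⟩, hw⟩
          exact ⟨hx, (hR x hx w).2 ⟨hw, hE⟩⟩
    _ ≤ ∑ w ∈ W, (1 : ℝ) := by
        refine sum_le_sum fun w _ => ?_
        rw [sum_const, nsmul_eq_mul, mul_one_div]
        exact div_self_le_one _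
    _ = W.card := by simp

variable [Fintype V]

/-- The set of neighbours of `x` in `H`. -/
noncomputable def nbrs (H : SimpleGraph V) (x : V) : Finset V := univ.filter (H.Adj x)

theorem mem_nbrs {H : SimpleGraph V} {x a : V} : a ∈ nbrs H x ↔ H.Adj x a := by simp [nbrs]

theorem card_nbrs_add_card_nbrs {H K : SimpleGraph V} (h : IsCompl H K) (x : V) :
    (nbrs H x).card + (nbrs K x).card + 1 = Fintype.card V := by
  have h1 : univ = insert x (nbrs H x ∪ nbrs K x) := by
    ext a
    simp only [mem_univ, mem_insert, mem_union, mem_nbrs, true_iff]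
    by_cases ha : a = x
    · exact Or.inl ha
    · have := isCompl_adj_iff h (Ne.symm ha)
      tauto
  have h2 : Disjoint (nbrs H x) (nbrs K x) := by
    rw [disjoint_left]
    intro a ha hb
    rw [mem_nbrs] at ha hb
    exact (isCompl_adj_iff h ha.ne).1 ha hb
  rw [← card_univ, h1, card_insert_of_notMem, card_union_of_disjoint h2]
  simp [mem_nbrs]

/-- If `H` is complete across many classes of `P`, and all degrees in the complementary graph `K` are
at most `Δ`, then every vertex of `P` has many neighbours in `H` outside `P`, while by
`HasBarriers.exists_cover` these neighbourhoods overlap little. Only classes meeting `C` are used, since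
their vertices have no neighbours in `Z`. -/
theorem HasBarriers.mul_le_mul {H K : SimpleGraph V} (hHK : IsCompl H K) {n Δ j : ℕ}
    (hH : HasBarriers H n) (hΔ : ∀ u, (nbrs K u).card ≤ Δ) {P C Z : Finset V} {f : V → V}
    (hf : CompleteAcross H P f) (hq : n + 2 ≤ (P.image f).card)
    (hj : ((P \ C).image f).card ≤ j) (hPZ : Disjoint P Z)
    (hCZ : ∀ a ∈ P, a ∈ C → ∀ z ∈ Z, ¬ H.Adj a z)
    (hlarge : P.card + 2 + 4 * n + 2 * Δ ≤ (P.image f).card + 2 * Fintype.card V)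
    (hmany : P.card + 2 * j + 2 ≤ 2 * (P.image f).card) :
    ((P.image f).card - j - 1 : ℝ) * (Fintype.card V - P.card - Δ) ≤
      (2 * n - P.card + 2) * (Fintype.card V - P.card - Z.card) := by
  have hP2 := hH.card_le_two_mul hf hq
  have hPq : (P.image f).card ≤ P.card := card_image_le
  -- one representative in `C` of each class that meets `C`
  obtain ⟨Q₁, hQ₁, hQ₁inj, hQ₁im⟩ : ∃ Q₁ ⊆ P ∩ C, Set.InjOn f Q₁ ∧
      Q₁.image f = (P ∩ C).image f := by
    have hch : ∀ c : V, ∃ x, c ∈ (P ∩ C).image f → x ∈ P ∩ C ∧ f x = c := by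
      intro c
      by_cases hc : c ∈ (P ∩ C).image f
      · obtain ⟨x, hx, hxc⟩ := mem_image.1 hc
        exact ⟨x, fun _ => ⟨hx, hxc⟩⟩
      · exact ⟨c, fun h => absurd h hc⟩
    choose t ht using hch
    refine ⟨((P ∩ C).image f).image t, ?_, ?_, ?_⟩
    · intro x hx
      obtain ⟨c, hc, rfl⟩ := mem_image.1 hx
      exact (ht c hc).1
    · intro x hx y hy hxy
      obtain ⟨c, hc, rfl⟩ := mem_image.1 (mem_coe.1 hx)
      obtain ⟨d, hd, rfl⟩ := mem_image.1 (mem_coe.1 hy)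
      rw [(ht c hc).2, (ht d hd).2] at hxy
      rw [hxy]
    · rw [image_image]
      ext c
      simp only [mem_image (f := f ∘ t), Function.comp]
      constructor
      · rintro ⟨d, hd, rfl⟩
        rw [(ht d hd).2]
        exact hd
      · intro hc
        exact ⟨c, hc, (ht c hc).2⟩
  have hQ₁card : (P.image f).card ≤ Q₁.card + j := by
    have h1 : Q₁.card = ((P ∩ C).image f).card := by rw [← hQ₁im, card_image_of_injOn hQ₁inj]
    have h2 : P.image f = (P ∩ C).image f ∪ (P \ C).image f := by
      rw [← image_union, union_comm, sdiff_union_inter]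
    have h3 := card_union_le ((P ∩ C).image f) ((P \ C).image f)
    rw [← h2] at h3
    omega
  have hQ₁ne : Q₁.Nonempty := card_pos.1 (by omega)
  -- the largest class is left out
  obtain ⟨xm, hxm, hmax⟩ := exists_max_image Q₁ (fun x => (labelClass P f x).card) hQ₁ne
  set Q := Q₁.erase xm with hQ
  have hQcard : Q.card + 1 = Q₁.card := card_erase_add_one hxm
  have hQmem : ∀ x ∈ Q, x ∈ P ∧ x ∈ C ∧ x ∈ Q₁ := fun x hx => by
    have h1 := mem_of_mem_erase hx
    have h2 := mem_inter.1 (hQ₁ h1)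
    exact ⟨h2.1, h2.2, h1⟩
  have hsmall : ∀ x ∈ Q, 2 * (labelClass P f x).card + (P.image f).card ≤ P.card + 2 := by
    intro x hx
    have h1 := hmax x (hQmem x hx).2.2
    have h2 := card_labelClass_add_card_labelClass_le (P := P) (f := f) (x := x) (y := xm)
      (fun h => (mem_erase.1 hx).1 (hQ₁inj (hQmem x hx).2.2 hxm h))
    omega
  have hclasses : ∑ x ∈ Q, (labelClass P f x).card ≤ P.card := by
    rw [← card_biUnion]
    · exact card_le_card (biUnion_subset.2 fun x _ => filter_subset _ _)
    · intro x hx y hy hxy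
      change Disjoint (labelClass P f x) (labelClass P f y)
      rw [disjoint_left]
      intro a ha hb
      rw [mem_labelClass] at ha hb
      exact hxy (hQ₁inj (hQmem x hx).2.2 (hQmem y hy).2.2 (ha.2.symm.trans hb.2))
  have hWcard : ((univ \ (P ∪ Z)).card : ℝ) = Fintype.card V - P.card - Z.card := by
    have h1 := card_sdiff_add_card_eq_card (subset_univ (P ∪ Z))
    rw [card_union_of_disjoint hPZ, card_univ] at h1
    have h2 : ((univ \ (P ∪ Z)).card : ℝ) + (P.card + Z.card) = Fintype.card V := by
      exact_mod_cast h1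
    linarith
  set N := Fintype.card V with hN
  have hρ : ∀ x ∈ Q, ((N : ℝ) - P.card - Δ) ≤ (nbrs H x \ P).card := by
    intro x hx
    have h1 : nbrs H x ⊆ (nbrs H x \ P) ∪ (P.erase x \ nbrs K x) := by
      intro a ha
      rw [mem_nbrs] at ha
      simp only [mem_union, mem_sdiff, mem_nbrs, mem_erase]
      have := (isCompl_adj_iff hHK ha.ne).1 ha
      have h2 := ha.ne'
      tauto
    have h2 := card_le_card h1
    have h3 := card_union_le (nbrs H x \ P) (P.erase x \ nbrs K x)
    have h4 : (P.erase x \ nbrs K x).card ≤ (P.erase x).card := card_le_card sdiff_subset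
    have h5 := card_erase_add_one (hQmem x hx).1
    have h6 := card_nbrs_add_card_nbrs hHK x
    have h7 := hΔ x
    have h8 : N ≤ (nbrs H x \ P).card + P.card + Δ := by omega
    have h9 : (N : ℝ) ≤ (nbrs H x \ P).card + P.card + Δ := by exact_mod_cast h8
    linarith
  have key := sum_div_le_card (E := H.Adj) (Q := Q) (W := univ \ (P ∪ Z))
    (R := fun x => nbrs H x \ P) (D := fun x => 2 * n + (labelClass P f x).card - P.card)
    (ρ := (N : ℝ) - P.card - Δ) ?_ hρ ?_ ?_
  · set a : ℝ := 2 * n - P.card + 2 with ha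
    have hP2' : (P.card : ℝ) ≤ 2 * n := by exact_mod_cast hP2
    have ha0 : 0 < a := by linarith
    have hρ0 : (0 : ℝ) ≤ (N : ℝ) - P.card - Δ := by
      have : P.card + Δ ≤ N := by omega
      have : (P.card : ℝ) + Δ ≤ N := by exact_mod_cast this
      linarith
    set ρ : ℝ := (N : ℝ) - P.card - Δ with hρdef
    -- the tangent of `1 / z` at `z = a`
    have htan : ∀ x ∈ Q, ρ * ((2 * a - (2 * n - P.card)) / a ^ 2) -
        ρ / a ^ 2 * (labelClass P f x).card ≤
          ρ / ((2 * n + (labelClass P f x).card - P.card : ℕ) : ℝ) := by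
      intro x hx
      have hc : (1 : ℝ) ≤ (labelClass P f x).card := by
        exact_mod_cast card_labelClass_pos (hQmem x hx).1
      rw [Nat.cast_sub (by omega)]
      push_cast
      set c : ℝ := ((labelClass P f x).card : ℝ)
      have hz : 0 < 2 * (n : ℝ) + c - P.card := by linarith
      have h1 : (2 * a - (2 * n + c - P.card)) / a ^ 2 ≤ 1 / (2 * (n : ℝ) + c - P.card) := by
        rw [div_le_div_iff₀ (by positivity) hz]
        nlinarith [sq_nonneg (a - (2 * (n : ℝ) + c - P.card))]
      have h2 := mul_le_mul_of_nonneg_left h1 hρ0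
      calc _ = ρ * ((2 * a - (2 * n + c - P.card)) / a ^ 2) := by ring
        _ ≤ ρ * (1 / (2 * (n : ℝ) + c - P.card)) := h2
        _ = _ := by ring
    have h1 := (sum_le_sum htan).trans key
    rw [sum_sub_distrib, sum_const, ← mul_sum, nsmul_eq_mul, hWcard] at h1
    have h2 : (∑ x ∈ Q, ((labelClass P f x).card : ℝ)) ≤ 2 * Q.card := by
      have : ∑ x ∈ Q, (labelClass P f x).card ≤ 2 * Q.card := by omega
      exact_mod_cast this
    have h3 := mul_le_mul_of_nonneg_left h2 (show 0 ≤ ρ / a ^ 2 by positivity)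
    have h4 : (Q.card : ℝ) * ρ / a ≤ N - P.card - Z.card := by
      refine le_trans (le_of_eq ?_) ((sub_le_sub_left h3 _).trans h1)
      rw [ha]
      rw [ha] at ha0
      field_simp
      ring
    rw [div_le_iff₀ ha0] at h4
    have h5 : ((P.image f).card - j - 1 : ℝ) ≤ Q.card := by
      have : (P.image f).card ≤ Q.card + 1 + j := by omega
      have : ((P.image f).card : ℝ) ≤ Q.card + 1 + j := by exact_mod_cast this
      linarith
    calc _ ≤ (Q.card : ℝ) * ρ := mul_le_mul_of_nonneg_right h5 hρ0
      _ ≤ _ := by linarith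
  · intro x hx w
    simp only [mem_sdiff, mem_nbrs, mem_univ, mem_union, true_and, not_or]
    refine ⟨fun h => ⟨⟨h.2, fun hz => ?_⟩, h.1.symm⟩, fun h => ⟨h.2.symm, h.1.1⟩⟩
    exact hCZ x (hQmem x hx).1 (hQmem x hx).2.1 w hz h.1
  · intro x hx
    have h1 := hsmall x hx
    have h2 : (2 * n + (labelClass P f x).card - P.card) + P.card + Δ ≤ N := by omega
    have h3 : (((2 * n + (labelClass P f x).card - P.card : ℕ) : ℝ)) + P.card + Δ ≤ N := by
      exact_mod_cast h2
    linarith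
  · intro x hx
    obtain ⟨X, -, Y, hY, hc, hno⟩ := hH.exists_cover hf hq (hQmem x hx).1 (R := nbrs H x \ P)
      (fun w hw => mem_nbrs.1 (mem_sdiff.1 hw).1) disjoint_sdiff
    refine ⟨X, Y, hY, by omega, fun w hw hwY a ha haX hax => ?_⟩
    exact hno w hw hwY a (hQmem a ha).1 haX
      fun h => hax (hQ₁inj (hQmem a ha).2.2 (hQmem x hx).2.2 h)

end DoubleCounting

/-! ### The giant class -/

section Nested

open Classical Finset

variable {V : Type*}

/-- Suppose that `B` is complete across the classes of a set `P` with more than `2 * n` vertices. Then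
one class is so large that in every neighbourhood of `B` that contains `P` up to a small class, each
barrier contains all the other classes of `P`. -/
theorem HasBarriers.exists_giant_class {B : SimpleGraph V} {n ε r : ℕ} (hB : HasBarriers B n)
    {P : Finset V} {f : V → V} (hf : CompleteAcross B P f) (hP : P.card = 2 * n + ε) (hε : 1 ≤ ε)
    (hεr : ε ≤ r) (hq : 2 * r + 2 ≤ (P.image f).card + ε) (hr : 7 * n + 79 ≤ 12 * r) :
    ∃ κ, 2 * r + 1 ≤ ε + n ∧ (P.filter fun a => f a ≠ κ).card ≤ n + 3 ∧
      (∃ y ∈ P, f y ≠ κ ∧ (labelClass P f y).card ≤ 4) ∧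
      ∀ y ∈ P, f y ≠ κ → (labelClass P f y).card ≤ 4 → ∀ A S g, P \ labelClass P f y ⊆ A →
        IsBarrier B n A S g → ∀ a ∈ P, f a ≠ κ → f a ≠ f y → a ∈ S := by
  have hmem : ∀ y a, a ∈ P \ labelClass P f y ↔ a ∈ P ∧ f a ≠ f y := by
    intro y a
    simp only [mem_sdiff, mem_labelClass]
    tauto
  have core : ∀ y, (labelClass P f y).card ≤ ε → ∀ A S g, P \ labelClass P f y ⊆ A →
      IsBarrier B n A S g → ∀ a ∈ P, f a ≠ f y → a ∉ S → ∀ b ∈ P, f b ≠ f y → b ∉ S →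
      f a = f b := by
    intro y hy A S g hA hS a ha hay haS b hb hby hbS
    by_contra hab
    have h1 := hS.card_add_card_le (P := P \ labelClass P f y) (f := f)
      (fun a ha b hb => hf a ((hmem y a).1 ha).1 b ((hmem y b).1 hb).1) hA
      (mem_sdiff.2 ⟨(hmem y a).2 ⟨ha, hay⟩, haS⟩) (mem_sdiff.2 ⟨(hmem y b).2 ⟨hb, hby⟩, hbS⟩) hab
    have h2 := card_sdiff_labelClass P f y
    omega
  have hPpos : 0 < P.card := by omega
  obtain ⟨y₀, hy₀, hle⟩ := exists_card_labelClass_mul_le f (card_pos.1 hPpos)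
  have hc4 : (labelClass P f y₀).card ≤ 4 := by
    by_contra! h
    have := Nat.mul_le_mul_right (P.image f).card h
    omega
  have hcε : (labelClass P f y₀).card ≤ ε := by
    rcases Nat.lt_or_ge (labelClass P f y₀).card 2 with h | h
    · omega
    · have := Nat.mul_le_mul_right (P.image f).card h
      omega
  obtain ⟨S₀, g₀, hS₀⟩ := hB y₀ (P \ labelClass P f y₀) fun a ha =>
    hf y₀ hy₀ a ((hmem y₀ a).1 ha).1 ((hmem y₀ a).1 ha).2.symm
  have hlt := hS₀.card_lt
  have hcard := card_sdiff_labelClass P f y₀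
  obtain ⟨a₀, ha₀⟩ : ((P \ labelClass P f y₀) \ S₀).Nonempty := by
    apply card_pos.1
    have := le_card_sdiff S₀ (P \ labelClass P f y₀)
    omega
  rw [mem_sdiff, hmem] at ha₀
  obtain ⟨⟨ha₀P, ha₀y⟩, ha₀S⟩ := ha₀
  have hgiant : n + 1 ≤ (labelClass P f a₀).card := by
    have h1 : (P \ labelClass P f y₀) \ S₀ ⊆ labelClass P f a₀ := by
      intro a ha
      rw [mem_sdiff, hmem] at ha
      exact mem_labelClass.2 ⟨ha.1.1, core y₀ hcε _ _ _ subset_rfl hS₀ a ha.1.1 ha.1.2 ha.2 a₀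
        ha₀P ha₀y ha₀S⟩
    have h2 := card_le_card h1
    have h3 := le_card_sdiff S₀ (P \ labelClass P f y₀)
    omega
  have general : ∀ y ∈ P, f y ≠ f a₀ → (labelClass P f y).card ≤ ε → ∀ A S g,
      P \ labelClass P f y ⊆ A → IsBarrier B n A S g →
      ∀ a ∈ P, f a ≠ f a₀ → f a ≠ f y → a ∈ S := by
    intro y hy hyκ hcy A S g hA hS a ha haκ hay
    by_contra haS
    obtain ⟨b, hb⟩ : (labelClass P f a₀ \ S).Nonempty := by
      apply card_pos.1
      have h1 := le_card_sdiff S (labelClass P f a₀)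
      have h2 := hS.card_lt
      omega
    rw [mem_sdiff, mem_labelClass] at hb
    apply haκ
    rw [← hb.1.2]
    exact core y hcy A S g hA hS a ha hay haS b hb.1.1 (hb.1.2 ▸ hyκ.symm) hb.2
  -- the classes other than those of `y₀` and `a₀` lie in `S₀`
  have hsub : (P.filter fun a => f a ≠ f a₀) \ labelClass P f y₀ ⊆ S₀ := by
    intro a ha
    rw [mem_sdiff, mem_filter, mem_labelClass] at ha
    exact general y₀ hy₀ ha₀y.symm hcε _ _ _ subset_rfl hS₀ a ha.1.1 ha.1.2
      fun h => ha.2 ⟨ha.1.1, h⟩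
  have hsub' := card_le_card hsub
  have hrn : 2 * r + 1 ≤ ε + n := by
    have h1 : (P.image f).card ≤
        ((P.filter fun a => f a ≠ f a₀) \ labelClass P f y₀).card + 2 :=
      card_image_le_card_add_two (κ := f y₀) (μ := f a₀) fun a ha h1 h2 => by
        simp only [mem_sdiff, mem_labelClass, mem_filter]
        tauto
    omega
  refine ⟨f a₀, hrn, ?_, ⟨y₀, hy₀, ha₀y.symm, hc4⟩, fun y hy hyκ hcy => ?_⟩
  · have := le_card_sdiff (labelClass P f y₀) (P.filter fun a => f a ≠ f a₀)
    omega
  · exact general y hy hyκ (by omega)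

end Nested

/-! ### Polynomial inequalities -/

section Numeric

/-- The inequality refuting the bound of `HasBarriers.mul_le_mul` for a barrier `S` in a neighbourhood
of size `2 * n + r'` with `r' ≤ #S`; here `u = #S - r'`. -/
theorem lt_of_numeric {n r r' M u : ℝ} (hn : 0 ≤ n) (hu0 : 0 ≤ u) (hu : u ≤ n - 1 - r') (hrr : r' ≤ r)
    (hnum : (n - 1 - r') * (2 * n + 1 + r - 2 * r') + 2 * M + 4 * n < (2 * r' + 1) * (M - r)) :
    (u + 2) * (M + 2 * n + u) < (2 * r' + u + 1) * (M - r + u) := by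
  have h1 : 0 ≤ (n - 1 - r' - u) * (2 * n + 1 + r - 2 * r') :=
    mul_nonneg (by linarith) (by linarith)
  nlinarith

theorem numeric_maxDegree {n r M : ℝ} (hM : 7 * n + 85 ≤ 6 * M) (hr : 7 * n + 79 ≤ 12 * r)
    (hrn : r ≤ n - 1) :
    (n - 1 - r) * (2 * n + 1 + r - 2 * r) + 2 * M + 4 * n < (2 * r + 1) * (M - r) := by
  have h1 : 0 ≤ (6 * M - (7 * n + 85)) * (2 * r - 1) := mul_nonneg (by linarith) (by linarith)
  have h2 : 0 ≤ (12 * r - (7 * n + 79)) * (n - 1 - r) := mul_nonneg (by linarith) (by linarith)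
  nlinarith

theorem numeric_otherDegree {n r r' M : ℝ} (hM : 7 * n + 85 ≤ 6 * M) (hr' : 2 * n + 30 ≤ 3 * r')
    (hr : 4 * r ≤ 3 * n + 6) (hrr : r' ≤ r) :
    (n - 1 - r') * (2 * n + 1 + r - 2 * r') + 2 * M + 4 * n < (2 * r' + 1) * (M - r) := by
  have h1 : 0 ≤ (6 * M - (7 * n + 85)) * (2 * r' - 1) := mul_nonneg (by linarith) (by linarith)
  have h2 : 0 ≤ (3 * n + 6 - 4 * r) * (n + r') := mul_nonneg (by linarith) (by linarith)
  have h3 : 0 ≤ (3 * r' - (2 * n + 30)) * (3 * n + 6 - 4 * r') :=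
    mul_nonneg (by linarith) (by linarith)
  nlinarith

/-- The bound of `HasBarriers.mul_le_mul` for the neighbourhood of a vertex `y` outside the giant
class forces `y` to have few neighbours outside `P`. -/
theorem numeric_blueDegree {n r M u h c ε : ℝ} (hM : 7 * n + 85 ≤ 6 * M)
    (hc0 : 0 ≤ c) (hc : c ≤ 4) (hr : 7 * n + 79 ≤ 12 * r) (hε : 2 * r + 1 ≤ ε + n) (hεr : ε ≤ r)
    (hh : M ≤ h + r) (hu0 : 0 ≤ u) (hu : u + h + 1 ≤ n + c)
    (hcount : (u + h - 2 * c + ε + 1) * (M - r + u) ≤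
      (u + 2) * (M + 2 * n + u - 2 * r + ε - 1)) : 2 * h ≤ n + 2 * c := by
  by_contra! hcon
  obtain ⟨k, rfl⟩ : ∃ k, h = k + c := ⟨h - c, by ring⟩
  have e1 : (k - c + ε + 1) * (M - r) ≤
      u * (2 * n - r - k + c) + 2 * (M + 2 * n - 2 * r + ε - 1) := by nlinarith
  have e2 : (k - 2 + 2 * r - n) * (M - r) ≤ (k - c + ε + 1) * (M - r) :=
    mul_le_mul_of_nonneg_right (by linarith) (by linarith)
  have e3 : u * (2 * n - r - k + c) ≤ (n - 1 - k) * (2 * n - r - k + 4) :=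
    mul_le_mul (by linarith) (by linarith) (by linarith) (by linarith)
  have e4 : (k - 2 + 2 * r - n) * (M - r) ≤
      (n - 1 - k) * (2 * n - r - k + 4) + 2 * (M + 2 * n - r - 1) := by linarith
  -- the left side minus the right side increases with `M` and with `k`
  have e5 : 0 ≤ (6 * M - (7 * n + 85)) * (k + 2 * r - n - 4) :=
    mul_nonneg (by linarith) (by linarith)
  set M₀ : ℝ := (7 * n + 85) / 6 with hM₀
  have e6 : (k - 2 + 2 * r - n) * (M₀ - r) ≤
      (n - 1 - k) * (2 * n - r - k + 4) + 2 * (M₀ + 2 * n - r - 1) := by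
    rw [hM₀]
    nlinarith
  have mono : ∀ k₀, k₀ ≤ k → (k₀ - 2 + 2 * r - n) * (M₀ - r) ≤
      (n - 1 - k₀) * (2 * n - r - k₀ + 4) + 2 * (M₀ + 2 * n - r - 1) := by
    intro k₀ hk
    have : 0 ≤ (k - k₀) * (M₀ - r + (2 * n - r - k + 4) + (n - 1 - k₀)) :=
      mul_nonneg (by linarith) (by rw [hM₀]; linarith)
    nlinarith
  rcases le_total (2 * n) (3 * r) with h3 | h3
  · have e7 := mono (n / 2) (by linarith)
    rw [hM₀] at e7
    nlinarith [mul_nonneg (sub_nonneg.2 h3) (show 0 ≤ n - 1 - r by linarith)]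
  · have e7 := mono (M₀ - r - 4) (by rw [hM₀]; linarith)
    rw [hM₀] at e7
    nlinarith [mul_nonneg (sub_nonneg.2 h3) (sub_nonneg.2 hr)]

end Numeric

/-! ### Barriers in large neighbourhoods are small -/

section Small

open Classical Finset

variable {V : Type*}

theorem IsBarrier.completeAcross {H K : SimpleGraph V} (hHK : IsCompl H K) {n : ℕ} {A S : Finset V}
    {f : V → V} (hS : IsBarrier H n A S f) : CompleteAcross K (A \ S) f := by
  intro a ha b hb hab
  refine (isCompl_adj_iff hHK.symm (ne_of_apply_ne f hab)).2 fun h => ?_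
  exact hab (hS.eq_of_adj a ha b hb h)

variable [Fintype V]

/-- A barrier `S` in a large neighbourhood of `H` is small: otherwise the complementary graph `K` would
be complete across so many classes that `HasBarriers.mul_le_mul` fails. -/
theorem IsBarrier.card_lt_of_numeric {H K : SimpleGraph V} (hHK : IsCompl H K) {n r r' : ℕ}
    (hK : HasBarriers K n) (hΔ : ∀ u, (nbrs H u).card ≤ 2 * n + r) {A S : Finset V} {f : V → V}
    (hS : IsBarrier H n A S f) (hA : A.card = 2 * n + r') (hrr : r' ≤ r) (hr' : n ≤ 2 * r')
    (hN : 5 * n + r ≤ r' + Fintype.card V)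
    (hnum : ((n : ℝ) - 1 - r') * (2 * n + 1 + r - 2 * r') + 2 * (Fintype.card V - 4 * n) + 4 * n <
      (2 * r' + 1) * (Fintype.card V - 4 * n - r)) : S.card < r' := by
  by_contra! hs
  have h1 := hS.card_le
  have h2 := hS.card_lt
  have h3 := card_sdiff_add_card_eq_card hS.subset
  have key := hK.mul_le_mul hHK.symm hΔ (C := univ) (Z := ∅) (j := 0) (hS.completeAcross hHK)
    (by omega) (by simp) (by simp) (by simp) (by omega) (by omega)
  obtain ⟨u, hu⟩ := Nat.exists_eq_add_of_le hs
  have hu' : (u : ℝ) ≤ n - 1 - r' := by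
    have : u + 1 + r' ≤ n := by omega
    have : (u : ℝ) + 1 + r' ≤ n := by exact_mod_cast this
    linarith
  have hlt := lt_of_numeric (Nat.cast_nonneg n) (Nat.cast_nonneg u) hu' (Nat.cast_le.2 hrr) hnum
  have hp : ((A \ S).card : ℝ) = 2 * n - u := by
    have : (A \ S).card + u = 2 * n := by omega
    have : ((A \ S).card : ℝ) + u = 2 * n := by exact_mod_cast this
    linarith
  have hq : (2 * r' + u + 1 : ℝ) ≤ ((A \ S).image f).card - ((0 : ℕ) : ℝ) - 1 := by
    have : 2 * r' + u + 2 ≤ ((A \ S).image f).card := by omega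
    have : (2 * r' + u + 2 : ℝ) ≤ ((A \ S).image f).card := by exact_mod_cast this
    push_cast
    linarith
  have hN' : (5 * n + r : ℝ) ≤ r' + Fintype.card V := by exact_mod_cast hN
  have hr'n : (r' : ℝ) ≤ n := by
    have : r' ≤ n := by omega
    exact_mod_cast this
  rw [hp] at key
  have h4 : (2 * r' + u + 1 : ℝ) * (Fintype.card V - 4 * n - r + u) ≤
      (((A \ S).image f).card - ((0 : ℕ) : ℝ) - 1) * (Fintype.card V - 4 * n - r + u) :=
    mul_le_mul_of_nonneg_right hq (by linarith [Nat.cast_nonneg (α := ℝ) u])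
  push_cast [card_empty] at key h4
  nlinarith

end Small

/-! ### Neighbours outside a large complete multipartite set -/

section Outside

open Classical Finset

variable {V : Type*} [Fintype V]

/-- A vertex `y` in a small class outside the giant class has few neighbours in `B` outside `P`: a
barrier in its neighbourhood contains the rest of the complement `T` of the giant class, so
`HasBarriers.mul_le_mul` applies to the part of the giant class that is left, whose vertices have no
neighbours in `T`. -/
theorem card_nbrs_sdiff_le {R B : SimpleGraph V} (hRB : IsCompl R B) {n r ε : ℕ}
    (hR : HasBarriers R n) (hB : HasBarriers B n) (hΔR : ∀ u, (nbrs R u).card ≤ 2 * n + r)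
    (hΔB : ∀ u, (nbrs B u).card ≤ 2 * n + r) (hN : 31 * n + 85 ≤ 6 * Fintype.card V)
    {P : Finset V} {f : V → V} (hf : CompleteAcross B P f) (hP : P.card = 2 * n + ε)
    (hεr : ε ≤ r) (hq : 2 * r + 2 ≤ (P.image f).card + ε) (hr : 7 * n + 79 ≤ 12 * r) {κ : V}
    (hrn : 2 * r + 1 ≤ ε + n) {y : V} (hy : y ∈ P)
    (hc : (labelClass P f y).card ≤ 4)
    (hgiant : ∀ A S g, P \ labelClass P f y ⊆ A → IsBarrier B n A S g →
      ∀ a ∈ P, f a ≠ κ → f a ≠ f y → a ∈ S) :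
    2 * ((nbrs B y \ P).card + ε) ≤ n + 2 * (labelClass P f y).card := by
  set T := P.filter fun a => f a ≠ κ with hT
  set A := nbrs B y \ labelClass P f y with hA
  have hPA : P \ labelClass P f y ⊆ A := by
    intro a ha
    rw [mem_sdiff] at ha
    refine mem_sdiff.2 ⟨mem_nbrs.2 (hf y hy a ha.1 fun h => ha.2 ?_), ha.2⟩
    exact mem_labelClass.2 ⟨ha.1, h.symm⟩
  obtain ⟨S, g, hS⟩ := hB y A fun a ha => mem_nbrs.1 (mem_sdiff.1 ha).1
  have hTS := hgiant A S g hPA hS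
  set b := (nbrs B y \ P).card with hb
  set c := (labelClass P f y).card with hcdef
  have hAcard : A.card = (P \ labelClass P f y).card + b := by
    rw [hb, ← card_union_of_disjoint (disjoint_sdiff.mono_left sdiff_subset)]
    congr 1
    ext a
    simp only [hA, mem_union, mem_sdiff]
    have h1 : a ∈ P → a ∉ labelClass P f y → a ∈ nbrs B y := fun h1 h2 =>
      (mem_sdiff.1 (hPA (mem_sdiff.2 ⟨h1, h2⟩))).1
    have h2 : a ∈ labelClass P f y → a ∈ P := fun h => (mem_labelClass.1 h).1
    tauto
  have hPc := card_sdiff_labelClass P f y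
  have hdeg : (nbrs B y).card + 1 ≤ A.card + c := by
    have h1 : nbrs B y ⊆ A ∪ (labelClass P f y).erase y := by
      intro a ha
      have := (mem_nbrs.1 ha).ne'
      simp only [hA, mem_union, mem_sdiff, mem_erase]
      tauto
    have h2 := card_le_card h1
    have h3 := card_union_le A ((labelClass P f y).erase y)
    have h4 := card_erase_add_one (mem_labelClass.2 ⟨hy, rfl⟩ : y ∈ labelClass P f y)
    omega
  have hAdeg : A.card ≤ 2 * n + r := (card_le_card sdiff_subset).trans (hΔB y)
  have hdegs := card_nbrs_add_card_nbrs hRB y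
  have hRdeg := hΔR y
  have hTcard : 2 * r + 1 ≤ T.card + ε := by
    have h1 : P.image f ⊆ insert κ (T.image f) := by
      intro e he
      obtain ⟨a, ha, rfl⟩ := mem_image.1 he
      by_cases h : f a = κ
      · exact mem_insert.2 (Or.inl h)
      · exact mem_insert_of_mem (mem_image_of_mem f (mem_filter.2 ⟨ha, h⟩))
    have h2 := card_le_card h1
    have h3 := card_insert_le κ (T.image f)
    have h4 : (T.image f).card ≤ T.card := card_image_le
    omega
  have hTScard : T.card ≤ S.card + c := by
    have h1 : T \ labelClass P f y ⊆ S := by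
      intro a ha
      rw [mem_sdiff, mem_filter, mem_labelClass] at ha
      exact hTS a ha.1.1 ha.1.2 fun h => ha.2 ⟨ha.1.1, h⟩
    have h2 := card_le_card h1
    have h3 := le_card_sdiff (labelClass P f y) T
    omega
  have h1 := hS.card_le
  have h2 := hS.card_lt
  have h3 := card_sdiff_add_card_eq_card hS.subset
  have hnot : ∀ a ∈ A \ S, a ∈ P → f a = κ := by
    intro a ha haP
    rw [mem_sdiff, mem_sdiff, mem_labelClass] at ha
    by_contra h
    exact ha.2 (hTS a haP h fun h' => ha.1.2 ⟨haP, h'⟩)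
  have hfg := hS.completeAcross hRB.symm
  have hqy : n + 2 ≤ ((A \ S).image g).card := by omega
  have key := hR.mul_le_mul hRB hΔB (C := P.filter fun a => f a = κ) (Z := T) (j := b) hfg hqy
    (by
      refine card_image_le.trans (card_le_card fun a ha => ?_)
      rw [mem_sdiff, mem_filter] at ha
      have h4 := mem_sdiff.1 ha.1
      refine mem_sdiff.2 ⟨(mem_sdiff.1 h4.1).1, fun h => ha.2 ⟨h, hnot a ha.1 h⟩⟩)
    (by
      rw [disjoint_left]
      intro a ha haT
      rw [mem_filter] at haT
      exact haT.2 (hnot a ha haT.1))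
    (by
      intro a _ haC z hz h
      rw [mem_filter] at haC hz
      refine (isCompl_adj_iff hRB h.ne).1 h (hf a haC.1 z hz.1 ?_)
      rw [haC.2]
      exact hz.2.symm)
    (by omega) (by omega)
  have hP2 := hR.card_le_two_mul hfg hqy
  obtain ⟨u, hu⟩ := Nat.exists_eq_add_of_le hP2
  have hp : ((A \ S).card : ℝ) = 2 * n - u := by
    have : ((2 * n : ℕ) : ℝ) = (((A \ S).card + u : ℕ) : ℝ) := by rw [hu]
    push_cast at this
    linarith
  have hMr : (4 * n + r : ℝ) ≤ Fintype.card V := by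
    have : 4 * n + r ≤ Fintype.card V := by omega
    exact_mod_cast this
  have hq' : ((u : ℝ) + (b + ε) - 2 * c + ε + 1) ≤ ((A \ S).image g).card - b - 1 := by
    have : u + ε + ε + 2 + 2 * b ≤ ((A \ S).image g).card + 2 * c := by omega
    have : (u + ε + ε + 2 + 2 * b : ℝ) ≤ ((A \ S).image g).card + 2 * c := by exact_mod_cast this
    linarith
  have hT' : (2 * r + 1 : ℝ) ≤ T.card + ε := by exact_mod_cast hTcard
  have hfinal := numeric_blueDegree (n := n) (r := r) (M := Fintype.card V - 4 * n) (u := u)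
    (h := b + ε) (c := c) (ε := ε) (by
      have : (31 * n + 85 : ℝ) ≤ 6 * Fintype.card V := by exact_mod_cast hN
      linarith) (Nat.cast_nonneg c) (by exact_mod_cast hc) (by exact_mod_cast hr)
    (by exact_mod_cast hrn) (by exact_mod_cast hεr)
    (by
      have : Fintype.card V ≤ b + ε + r + 4 * n := by omega
      have : (Fintype.card V : ℝ) ≤ b + ε + r + 4 * n := by exact_mod_cast this
      linarith) (Nat.cast_nonneg u)
    (by
      have : u + (b + ε) + 1 ≤ n + c := by omega
      exact_mod_cast this)
    (by
      rw [hp] at key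
      push_cast at key
      have hu0 : (0 : ℝ) ≤ u := Nat.cast_nonneg u
      calc _ ≤ (((A \ S).image g).card - b - 1 : ℝ) * (Fintype.card V - 4 * n - r + u) :=
            mul_le_mul_of_nonneg_right hq' (by linarith)
        _ ≤ ((u : ℝ) + 2) * (Fintype.card V - (2 * n - u) - T.card) := by linarith
        _ ≤ _ := mul_le_mul_of_nonneg_left (by linarith) (by linarith))
  exact_mod_cast hfinal

end Outside

/-! ### The extremal vertex -/

section Contradiction

open Classical Finset

variable {V : Type*}

/-- A bipartite graph between `t` and `q` vertices cannot have degrees at most `β` on the first side and at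
least `t - d` on the second one. -/
theorem numeric_final {n t q β d : ℝ} (hn : 0 ≤ n) (ht : 19 * n + 396 ≤ 24 * t)
    (hq : 7 * n + 141 ≤ 6 * q) (hβ : 6 * β ≤ n - 83) (hd : 3 * d ≤ 2 * n - 45) :
    t * β < q * (t - d) := by
  have h1 : t * (6 * β) ≤ t * (n - 83) := mul_le_mul_of_nonneg_left hβ (by linarith)
  have h2 : (7 * n + 141) * (t - d) ≤ 6 * q * (t - d) :=
    mul_le_mul_of_nonneg_right hq (by linarith)
  nlinarith

/-- If every `u ∈ T` has at most `β` neighbours in `Q`, then some `w ∈ Q` has at most the average number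
of neighbours in `T`. -/
theorem exists_card_filter_mul_le {E : V → V → Prop} {T Q : Finset V} (hQ : Q.Nonempty) {β : ℕ}
    (h : ∀ u ∈ T, (Q.filter fun w => E u w).card ≤ β) :
    ∃ w ∈ Q, Q.card * (T.filter fun u => E u w).card ≤ T.card * β := by
  by_contra! hcon
  have h1 := sum_card_bipartiteAbove_eq_sum_card_bipartiteBelow (s := T) (t := Q) E
  have h2 : ∑ u ∈ T, (bipartiteAbove E Q u).card ≤ T.card * β := by
    rw [← smul_eq_mul]
    exact sum_le_card_nsmul _ _ _ h
  have h3 : Q.card * (T.card * β) < ∑ w ∈ Q, Q.card * (bipartiteBelow E T w).card := by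
    rw [← smul_eq_mul (a := Q.card), ← sum_const]
    exact sum_lt_sum_of_nonempty hQ hcon
  rw [← mul_sum, ← h1] at h3
  exact absurd (Nat.mul_le_mul_left Q.card h2) (not_le.2 h3)

/-- If `R` is complete across the classes of a large set `P`, and the vertices of a large set `T` have few
`B`-neighbours in `P`, then the edges of `R` between `P` and `T` have no small cover, against
`HasBarriers.exists_cover` for an average vertex `w` of the small classes of `P`. -/
theorem false_of_few_nbrs {R B : SimpleGraph V} (hRB : IsCompl R B) {n β : ℕ}
    (hR : HasBarriers R n) {P T : Finset V} {f : V → V} (hf : CompleteAcross R P f)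
    (hq : n + 2 ≤ (P.image f).card) (hPT : Disjoint P T)
    (hβ : ∀ u ∈ T, (P.filter fun w => B.Adj u w).card ≤ β)
    (hP : 2 * n + β + 8 ≤ 2 * P.card) (hβn : 6 * β + 83 ≤ n) (hT : 19 * n + 396 ≤ 24 * T.card)
    (hPn : 4 * n + 54 ≤ 3 * P.card)
    (hsmall : 28 * n + 564 + 6 * P.card ≤ 30 * (P.image f).card) : False := by
  set Q := P.filter fun x => (labelClass P f x).card ≤ 4 with hQdef
  have hQcard : 7 * n + 141 ≤ 6 * Q.card := by
    have := five_mul_card_image_le P f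
    rw [← hQdef] at this
    omega
  have hQpos : 0 < Q.card := by omega
  obtain ⟨w, hw, hle⟩ := exists_card_filter_mul_le (E := B.Adj) (T := T) (card_pos.1 hQpos)
    fun u hu => (card_le_card (filter_subset_filter _ (filter_subset _ _))).trans (hβ u hu)
  rw [hQdef, mem_filter] at hw
  obtain ⟨X, -, Y, hY, hXY, hno⟩ := hR.exists_cover hf hq hw.1 (R := T.filter fun u => R.Adj w u)
    (fun u hu => (mem_filter.1 hu).2) (hPT.mono_right (filter_subset _ _))
  -- all `R`-neighbours of `w` in `T` belong to the cover
  have hsub : T.filter (fun u => R.Adj w u) ⊆ Y := by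
    intro u hu
    by_contra huY
    have huT := (mem_filter.1 hu).1
    have h1 : P \ (X ∪ labelClass P f w) ⊆ P.filter fun a => B.Adj u a := by
      intro a ha
      rw [mem_sdiff, mem_union, not_or, mem_labelClass] at ha
      have h2 := hno u hu huY a ha.1 ha.2.1 fun h => ha.2.2 ⟨ha.1, h⟩
      have h3 : u ≠ a := fun h => disjoint_left.1 hPT ha.1 (h ▸ huT)
      exact mem_filter.2 ⟨ha.1, (isCompl_adj_iff hRB.symm h3).2 h2⟩
    have h2 := card_le_card h1
    have h3 := le_card_sdiff (X ∪ labelClass P f w) P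
    have h4 := card_union_le X (labelClass P f w)
    have h5 := hβ u huT
    omega
  have h1 := card_le_card hsub
  have h2 : T.card ≤ (T.filter fun u => R.Adj w u).card + (T.filter fun u => B.Adj u w).card := by
    refine (card_le_card fun u hu => ?_).trans (card_union_le _ _)
    have h3 : w ≠ u := fun h => disjoint_left.1 hPT hw.1 (h ▸ hu)
    have h4 := isCompl_adj_iff hRB h3
    rw [B.adj_comm w u] at h4
    simp only [mem_union, mem_filter]
    tauto
  set e := (T.filter fun u => B.Adj u w).card
  have h3 : (2 * n + 3 : ℝ) - P.card ≥ T.card - e := by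
    have : T.card + P.card ≤ 2 * n + 3 + e := by omega
    have : (T.card + P.card : ℝ) ≤ 2 * n + 3 + e := by exact_mod_cast this
    linarith
  have h4 := numeric_final (n := n) (t := T.card) (q := Q.card) (β := β)
    (d := 2 * n + 3 - P.card) (Nat.cast_nonneg n) (by exact_mod_cast hT) (by exact_mod_cast hQcard)
    (by
      have : (6 * β + 83 : ℝ) ≤ n := by exact_mod_cast hβn
      linarith)
    (by
      have : (4 * n + 54 : ℝ) ≤ 3 * P.card := by exact_mod_cast hPn
      linarith)
  have h5 : (Q.card : ℝ) * (T.card - (2 * n + 3 - P.card)) ≤ Q.card * e :=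
    mul_le_mul_of_nonneg_left (by linarith) (Nat.cast_nonneg _)
  have h6 : (Q.card : ℝ) * e ≤ T.card * β := by exact_mod_cast hle
  linarith

variable [Fintype V]

/-- There is no colouring of a complete graph on `31 / 6 * n + 85 / 6` or more vertices with barriers in
all neighbourhoods. The vertex `v` has the largest degree in either colour. -/
theorem false_of_hasBarriers {R B : SimpleGraph V} (hRB : IsCompl R B) {n : ℕ}
    (hR : HasBarriers R n) (hB : HasBarriers B n) (hN : 31 * n + 85 ≤ 6 * Fintype.card V) (v : V)
    (hmaxR : ∀ u, (nbrs R u).card ≤ (nbrs R v).card)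
    (hmaxB : ∀ u, (nbrs B u).card ≤ (nbrs R v).card) : False := by
  have hN' : (31 * n + 85 : ℝ) ≤ 6 * Fintype.card V := by exact_mod_cast hN
  have hv := card_nbrs_add_card_nbrs hRB v
  have hvB := hmaxB v
  obtain ⟨r, hr⟩ : ∃ r, (nbrs R v).card = 2 * n + r := Nat.exists_eq_add_of_le (by omega)
  rw [hr] at hmaxR hmaxB
  have hr12 : 7 * n + 79 ≤ 12 * r := by omega
  obtain ⟨S, f, hS⟩ := hR v (nbrs R v) fun a ha => mem_nbrs.1 ha
  have hSlt := hS.card_lt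
  have hSr : S.card < r := by
    by_contra! h
    refine absurd (hS.card_lt_of_numeric hRB hB hmaxR hr le_rfl (by omega) (by omega) ?_)
      (not_lt.2 h)
    refine numeric_maxDegree (by linarith) (by exact_mod_cast hr12) ?_
    have : r + 1 ≤ n := by omega
    have : (r + 1 : ℝ) ≤ n := by exact_mod_cast this
    linarith
  have hScard := hS.card_le
  have hPcard := card_sdiff_add_card_eq_card hS.subset
  have hf := hS.completeAcross hRB
  set P := nbrs R v \ S with hPdef
  obtain ⟨ε, hε⟩ := Nat.exists_eq_add_of_le hSr.le
  obtain ⟨κ, hrn, hTle, ⟨y, hy, hyκ, hyc⟩, hgiant⟩ := hB.exists_giant_class (ε := ε) (r := r) hf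
    (by omega) (by omega) (by omega) (by omega) hr12
  have hout : ∀ u ∈ P, f u ≠ κ → (labelClass P f u).card ≤ 4 →
      2 * ((nbrs B u \ P).card + ε) ≤ n + 8 := fun u hu huκ huc =>
    (card_nbrs_sdiff_le hRB hR hB hmaxR hmaxB hN hf (by omega) (by omega) (by omega) hr12 hrn hu huc
      (hgiant u hu huκ huc)).trans (by omega)
  -- `y` has large degree in `R`
  have hyB : (nbrs B y).card + 1 ≤ P.card + (nbrs B y \ P).card := by
    have h1 : nbrs B y ⊆ P.erase y ∪ (nbrs B y \ P) := by
      intro a ha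
      have := (mem_nbrs.1 ha).ne'
      simp only [mem_union, mem_sdiff, mem_erase]
      tauto
    have h2 := card_le_card h1
    have h3 := card_union_le (P.erase y) (nbrs B y \ P)
    have h4 := card_erase_add_one hy
    omega
  have hydeg := card_nbrs_add_card_nbrs hRB y
  have hyout := hout y hy hyκ hyc
  obtain ⟨r', hr'⟩ : ∃ r', (nbrs R y).card = 2 * n + r' := Nat.exists_eq_add_of_le (by omega)
  have hrr : r' ≤ r := by
    have := hmaxR y
    omega
  have hr3 : 2 * n + 30 ≤ 3 * r' := by omega
  obtain ⟨S', f', hS'⟩ := hR y (nbrs R y) fun a ha => mem_nbrs.1 ha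
  have hSlt' := hS'.card_lt
  have hSr' : S'.card < r' := by
    refine hS'.card_lt_of_numeric hRB hB hmaxR hr' hrr (by omega) (by omega) ?_
    refine numeric_otherDegree (by linarith) (by exact_mod_cast hr3) ?_ (by exact_mod_cast hrr)
    have : 4 * r ≤ 3 * n + 6 := by omega
    exact_mod_cast this
  have hScard' := hS'.card_le
  have hPcard' := card_sdiff_add_card_eq_card hS'.subset
  have hf' := hS'.completeAcross hRB
  set P' := nbrs R y \ S' with hPdef'
  obtain ⟨ε', hε'⟩ := Nat.exists_eq_add_of_le hSr'.le
  obtain ⟨κ', hrn', -, ⟨y', hy', hyκ', hyc'⟩, hgiant'⟩ := hB.exists_giant_class (ε := ε') (r := r')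
    hf' (by omega) (by omega) (by omega) (by omega) (by omega)
  -- the set across which `R` is complete, in the neighbourhood of `y`
  obtain ⟨S₂, f₂, hS₂⟩ := hB y' (P' \ labelClass P' f' y') fun a ha => by
    rw [mem_sdiff, mem_labelClass] at ha
    exact hf' y' hy' a ha.1 fun h => ha.2 ⟨ha.1, h.symm⟩
  have hS₂large : (P'.image f').card ≤ S₂.card + 2 :=
    card_image_le_card_add_two (hgiant' y' hy' hyκ' hyc' _ _ _ subset_rfl hS₂)
  have hS₂card := hS₂.card_le
  have hS₂lt := hS₂.card_lt
  have hP₂card := card_sdiff_add_card_eq_card hS₂.subset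
  have hcl' := card_sdiff_labelClass P' f' y'
  have hf₂ := hS₂.completeAcross hRB.symm
  set P₂ := (P' \ labelClass P' f' y') \ S₂ with hP₂def
  have hP₂R : ∀ a ∈ P₂, R.Adj y a := fun a ha =>
    mem_nbrs.1 (mem_sdiff.1 (mem_sdiff.1 (mem_sdiff.1 ha).1).1).1
  -- the small classes of `P` outside the giant class and the class of `y`
  set T := P.filter fun a => f a ≠ κ with hT
  set T₀ := T.filter fun a => (labelClass T f a).card ≤ 4 with hT₀
  set T₁ := T₀ \ labelClass P f y with hT₁
  have hclass : ∀ a ∈ T, labelClass T f a = labelClass P f a := by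
    intro a ha
    ext b
    rw [hT, mem_filter] at ha
    simp only [mem_labelClass, hT, mem_filter]
    refine ⟨fun h => ⟨h.1.1, h.2⟩, fun h => ⟨⟨h.1, ?_⟩, h.2⟩⟩
    rw [h.2]
    exact ha.2
  have hT₁mem : ∀ u ∈ T₁, u ∈ P ∧ f u ≠ κ ∧ (labelClass P f u).card ≤ 4 ∧ f u ≠ f y := by
    intro u hu
    rw [hT₁, mem_sdiff, hT₀, mem_filter, mem_labelClass] at hu
    have h1 := hclass u hu.1.1
    rw [h1] at hu
    have h2 := mem_filter.1 hu.1.1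
    exact ⟨h2.1, h2.2, hu.1.2, fun h => hu.2 ⟨h2.1, h⟩⟩
  have hT₁card : 5 * (2 * r + 1) ≤ 5 * ε + (n + 3) + 4 * (T₁.card + 4) := by
    have h1 := five_mul_card_image_le T f
    have h2 : P.image f ⊆ insert κ (T.image f) := by
      intro e he
      obtain ⟨a, ha, rfl⟩ := mem_image.1 he
      by_cases h : f a = κ
      · exact mem_insert.2 (Or.inl h)
      · exact mem_insert_of_mem (mem_image_of_mem f (mem_filter.2 ⟨ha, h⟩))
    have h3 := card_le_card h2
    have h4 := card_insert_le κ (T.image f)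
    have h5 := le_card_sdiff (labelClass P f y) T₀
    rw [← hT₁] at h5
    rw [← hT₀] at h1
    omega
  have hfew : ∀ u ∈ T₁, (P₂.filter fun w => B.Adj u w).card ≤ (n + 8) / 2 - ε + 3 := by
    intro u hu
    obtain ⟨huP, huκ, huc, -⟩ := hT₁mem u hu
    have h1 : (P₂.filter fun w => B.Adj u w) ⊆ (nbrs B u \ P) ∪ (labelClass P f y).erase y := by
      intro a ha
      rw [mem_filter] at ha
      have hya := hP₂R a ha.1
      by_cases haP : a ∈ P
      · refine mem_union_right _ (mem_erase.2 ⟨hya.ne', mem_labelClass.2 ⟨haP, ?_⟩⟩)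
        by_contra h
        exact (isCompl_adj_iff hRB hya.ne).1 hya (hf y hy a haP fun h' => h h'.symm)
      · exact mem_union_left _ (mem_sdiff.2 ⟨mem_nbrs.2 ha.2, haP⟩)
    have h2 := card_le_card h1
    have h3 := card_union_le (nbrs B u \ P) ((labelClass P f y).erase y)
    have h4 := card_erase_add_one (mem_labelClass.2 ⟨hy, rfl⟩ : y ∈ labelClass P f y)
    have h5 := hout u huP huκ huc
    omega
  have hdisj : Disjoint P₂ T₁ := by
    rw [disjoint_left]
    intro a ha haT
    obtain ⟨haP, -, -, hay⟩ := hT₁mem a haT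
    have hya := hP₂R a ha
    exact (isCompl_adj_iff hRB hya.ne).1 hya (hf y hy a haP hay.symm)
  exact false_of_few_nbrs hRB hR hf₂ (by omega) hdisj hfew (by omega) (by omega) (by omega)
    (by omega) (by omega)

theorem fan_isContained_or_compl {n : ℕ} (hn : 1 ≤ n) (G : SimpleGraph V)
    (hN : 31 * n + 85 ≤ 6 * Fintype.card V) :
    (fanGraph n).IsContained G ∨ (fanGraph n).IsContained Gᶜ := by
  by_contra h
  rw [not_or] at h
  have hG := hasBarriers_of_not_isContained hn h.1
  have hGc := hasBarriers_of_not_isContained hn h.2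
  have hpos : 0 < Fintype.card V := by omega
  have : Nonempty V := Fintype.card_pos_iff.1 hpos
  obtain ⟨v, -, hv⟩ := exists_max_image univ (fun u => (nbrs G u).card) univ_nonempty
  obtain ⟨w, -, hw⟩ := exists_max_image univ (fun u => (nbrs Gᶜ u).card) univ_nonempty
  rcases le_total (nbrs Gᶜ w).card (nbrs G v).card with hle | hle
  · exact false_of_hasBarriers isCompl_compl hG hGc hN v (fun u => hv u (mem_univ u))
      fun u => (hw u (mem_univ u)).trans hle
  · exact false_of_hasBarriers isCompl_compl.symm hGc hG hN w (fun u => hw u (mem_univ u))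
      fun u => (hv u (mem_univ u)).trans hle

end Contradiction

/-- The first conjunct says that the Ramsey number is attained, so that the bound in the second
one is not about a default value. The third one is the same bound in terms of graphs. -/
theorem mainTheorem1 (n : ℕ) (hn : 1 ≤ n) :
    IsLeast (ramseySet (fanGraph n) (fanGraph n)) (ramseyNumber (fanGraph n) (fanGraph n)) ∧
    (ramseyNumber (fanGraph n) (fanGraph n) : ℝ) ≤ 31 / 6 * (n : ℝ) + 15 ∧
    ∀ (V : Type*) [Fintype V] (G : SimpleGraph V),
      Fintype.card V = ⌊31 / 6 * (n : ℝ) + 15⌋₊ →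
        (fanGraph n).IsContained G ∨ (fanGraph n).IsContained Gᶜ := by
  have hpos : (0 : ℝ) ≤ 31 / 6 * (n : ℝ) + 15 := by positivity
  set N := ⌊31 / 6 * (n : ℝ) + 15⌋₊ with hNdef
  have hN : 31 * n + 85 ≤ 6 * N := by
    have h1 := Nat.lt_floor_add_one (31 / 6 * (n : ℝ) + 15)
    rw [← hNdef] at h1
    have h2 : (31 * n + 84 : ℝ) < 6 * N := by linarith
    have h3 : 31 * n + 84 < 6 * N := by exact_mod_cast h2
    exact h3
  have hmem : N ∈ ramseySet (fanGraph n) (fanGraph n) := by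
    refine ⟨by omega, fun C => ?_⟩
    rcases fan_isContained_or_compl hn (C.labelGraph 0) (by simpa using hN) with h | h
    · exact Or.inl h
    · refine Or.inr (h.mono_right fun a b hab => ?_)
      rw [SimpleGraph.compl_adj] at hab
      rw [SimpleGraph.EdgeLabeling.labelGraph_adj] at hab ⊢
      have hne : (⊤ : SimpleGraph (Fin N)).Adj a b := hab.1
      refine ⟨hne, ?_⟩
      by_contra h1
      refine hab.2 ⟨hne, ?_⟩
      omega
  refine ⟨⟨Nat.sInf_mem ⟨N, hmem⟩, fun m hm => Nat.sInf_le hm⟩, ?_, fun V _ G hV => ?_⟩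
  · calc (ramseyNumber (fanGraph n) (fanGraph n) : ℝ) ≤ N := by exact_mod_cast Nat.sInf_le hmem
      _ ≤ _ := Nat.floor_le hpos
  · exact fan_isContained_or_compl hn G (by rw [hV]; exact hN)
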